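/- A pre-meadow is a set $P$ with operations $+,-,\cdot$ and constants $0,1$ such that, for all $x,y,z\in P$: $(x+y)+z=x+(y+z)$, $x+y=y+x$, $x+0=x$, $x+(-x)=0\cdot x$, $(x\cdot y)\cdot z=x\cdot(y\cdot z)$, $x\cdot y=y\cdot x$, $1\cdot x=x$, $x\cdot(y+z)=x\cdot y+x\cdot z$, $-(-x)=x$, and $0\cdot(x+y)=0\cdot x\cdot y$. For $z\in P$ let $P_z=\{x\in P\mid 0\cdot x=z\}$. $P$ is a pre-meadow with $\mathbf a$ if there is a unique $z\in 0\cdot P$ with $|P_z|=1$ and this element, denoted $\mathbf a$, satisfies $x+\mathbf a=\mathbf a$ for all $x\in P$. A common meadow is a pre-meadow with $\mathbf a$ together with a map $x\mapsto x^{-1}$ such that $x\cdot x^{-1}=1+0\cdot x^{-1}$, $(x\cdot y)^{-1}=x^{-1}\cdot y^{-1}$, $(1+0\cdot x)^{-1}=1+0\cdot x$ and $0^{-1}=\mathbf a$. Isomorphisms are bijections preserving the operations and constants. The order of $P$ is its number of elements. For a commutative ring $R$, the pre-meadow $R\to\{\mathbf a\}$ ("$R$ with $\mathbf a$ adjoined")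 is $R\sqcup\{\mathbf a\}$ with the operations of $R$ on $R$ and value $\mathbf a$ whenever an argument is $\mathbf a$. For a homomorphism $f:R\to S$ of commutative rings, the pre-meadow $R\xrightarrow{f}S\to\{\mathbf a\}$ is $R\sqcup S\sqcup\{\mathbf a\}$, where $R$ and $S$ keep their operations, $x+s=f(x)+s$ and $x\cdot s=f(x)\cdot s$ for $x\in R$, $s\in S$ (and symmetrically), the value is $\mathbf a$ whenever an argument is $\mathbf a$, and $0,1$ are those of $R$. Theorem. Up to isomorphism there are exactly $5$ pre-meadows with $\mathbf a$ of order $5$, namely the pairwise non-isomorphic $$\mathbb Z_4\to\{\mathbf a\},\quad \mathbb Z_2\times\mathbb Z_2\to\{\mathbf a\},\quad \mathbb F_4\to\{\mathbf a\},\quad \mathcal M_2\to\{\mathbf a\},\quad \mathbb Z_2\xrightarrow{\mathrm{Id}}\mathbb Z_2\to\{\mathbf a\},$$ where $\mathbb F_4$ is the field with four elements and $\mathcal M_2=\left\{\begin{pmatrix}x&y\\0&x\end{pmatrix}\mid x,y\in\mathbb Z_2\right\}\cong\mathbb Z_2[x]/(x^2)$. All are common meadows: every pre-meadow with $\mathbf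 a$ of order $5$ carries exactly one inverse function making it a common meadow. Consequently the same five structures, with their inverse functions, are, up to isomorphism of common meadows, exactly the common meadows of order $5$. -/

import Mathlib

universe u v

/-- A pre-meadow: a set with two operations, a negation and constants `0`, `1` satisfying the
ten defining equations. -/
class PreMeadow (P : Type u) extends Zero P, One P, Add P, Neg P, Mul P where
  add_assoc' : ∀ x y z : P, (x + y) + z = x + (y + z)
  add_comm' : ∀ x y : P, x + y = y + x
  add_zero' : ∀ x : P, x + 0 = x
  add_neg' : ∀ x : P, x + (-x) = 0 * x
  mul_assoc' : ∀ x y z : P, (x * y) * z = x * (y * z)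
  mul_comm' : ∀ x y : P, x * y = y * x
  one_mul' : ∀ x : P, 1 * x = x
  mul_add' : ∀ x y z : P, x * (y + z) = x * y + x * z
  neg_neg' : ∀ x : P, -(-x) = x
  zero_mul_add' : ∀ x y : P, 0 * (x + y) = 0 * x * y

section Basic

/-- The set `P_z = {x ∈ P | 0 * x = z}`. -/
def PreMeadow.fiber {P : Type u} [PreMeadow P] (z : P) : Set P := {x | 0 * x = z}

/-- The set `0 * P`. -/
def PreMeadow.zeroMul (P : Type u) [PreMeadow P] : Set P := {z | ∃ x : P, z = 0 * x}

/-- `a` is the unique `z ∈ 0 * P` with `|P_z| = 1`, and `x + a = a` for all `x`. -/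
structure PreMeadow.IsErr {P : Type u} [PreMeadow P] (a : P) : Prop where
  mem : a ∈ PreMeadow.zeroMul P
  card_fiber : (PreMeadow.fiber a).ncard = 1
  unique : ∀ z ∈ PreMeadow.zeroMul P, (PreMeadow.fiber z).ncard = 1 → z = a
  add_err : ∀ x : P, x + a = a

/-- `P` is a pre-meadow with `a`. -/
def PreMeadow.WithErr (P : Type u) [PreMeadow P] : Prop := ∃ a : P, PreMeadow.IsErr a

/-- `inv` is an inverse function turning the pre-meadow with `a` on `P` into a
common meadow. -/
structure PreMeadow.IsCommonInverse {P : Type u} [PreMeadow P] (inv : P → P) : Prop where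
  withErr : PreMeadow.WithErr P
  mul_inv : ∀ x : P, x * inv x = 1 + 0 * inv x
  inv_mul : ∀ x y : P, inv (x * y) = inv x * inv y
  inv_one_add : ∀ x : P, inv (1 + 0 * x) = 1 + 0 * x
  inv_zero : PreMeadow.IsErr (inv 0)

/-- Isomorphisms of pre-meadows. -/
structure PreMeadowIso (P : Type u) (Q : Type v) [PreMeadow P] [PreMeadow Q] extends P ≃ Q where
  map_zero' : toFun 0 = 0
  map_one' : toFun 1 = 1
  map_add' : ∀ x y : P, toFun (x + y) = toFun x + toFun y
  map_neg' : ∀ x : P, toFun (-x) = -toFun x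
  map_mul' : ∀ x y : P, toFun (x * y) = toFun x * toFun y

end Basic

section RingToErr

/-- The disjoint union `R ⊔ {a}`, carrier of the pre-meadow of the chain `R → {a}`. -/
inductive AdjoinErr (R : Type u) : Type u
  | of : R → AdjoinErr R
  | err : AdjoinErr R

/-- Inside `R` the operations are those of `R`; if an argument is `a`, the value is `a`. -/
instance AdjoinErr.instPreMeadow (R : Type u) [CommRing R] : PreMeadow (AdjoinErr R) where
  zero := .of 0
  one := .of 1
  add
    | .of x, .of y => .of (x + y)
    | _, _ => .err
  neg
    | .of x => .of (-x)
    | .err => .err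
  mul
    | .of x, .of y => .of (x * y)
    | _, _ => .err
  add_assoc' := by
    rintro (x | _) (y | _) (z | _) <;> first | rfl | exact congrArg _ (add_assoc x y z)
  add_comm' := by
    rintro (x | _) (y | _) <;> first | rfl | exact congrArg _ (add_comm x y)
  add_zero' := by
    rintro (x | _) <;> first | rfl | exact congrArg _ (add_zero x)
  add_neg' := by
    rintro (x | _)
    · exact congrArg AdjoinErr.of (show x + -x = 0 * x by ring)
    · rfl
  mul_assoc' := by
    rintro (x | _) (y | _) (z | _) <;> first | rfl | exact congrArg _ (mul_assoc x y z)
  mul_comm' := by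
    rintro (x | _) (y | _) <;> first | rfl | exact congrArg _ (mul_comm x y)
  one_mul' := by
    rintro (x | _) <;> first | rfl | exact congrArg _ (one_mul x)
  mul_add' := by
    rintro (x | _) (y | _) (z | _) <;> first | rfl | exact congrArg _ (mul_add x y z)
  neg_neg' := by
    rintro (x | _) <;> first | rfl | exact congrArg _ (neg_neg x)
  zero_mul_add' := by
    rintro (x | _) (y | _)
    · exact congrArg AdjoinErr.of (show 0 * (x + y) = 0 * x * y by ring)
    all_goals rfl

end RingToErr

section RingToRingToErr

/-- The disjoint union `R ⊔ S ⊔ {a}`, carrier of the pre-meadow of a chain `R → S → {a}`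
whose first arrow is the ring homomorphism `f`. -/
inductive ChainErr {R : Type u} {S : Type v} [CommRing R] [CommRing S] (f : R →+* S) :
    Type (max u v)
  | top : R → ChainErr f
  | mid : S → ChainErr f
  | err : ChainErr f

/-- Two elements are first transported to the meet of their levels, then added or multiplied
in the ring at that level. -/
instance ChainErr.instPreMeadow {R : Type u} {S : Type v} [CommRing R] [CommRing S]
    (f : R →+* S) : PreMeadow (ChainErr f) where
  zero := .top 0
  one := .top 1
  add
    | .top x, .top y => .top (x + y)
    | .top x, .mid y => .mid (f x + y)
    | .mid x, .top y => .mid (x + f y)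
    | .mid x, .mid y => .mid (x + y)
    | .err, _ => .err
    | _, .err => .err
  neg
    | .top x => .top (-x)
    | .mid x => .mid (-x)
    | .err => .err
  mul
    | .top x, .top y => .top (x * y)
    | .top x, .mid y => .mid (f x * y)
    | .mid x, .top y => .mid (x * f y)
    | .mid x, .mid y => .mid (x * y)
    | .err, _ => .err
    | _, .err => .err
  add_assoc' := by
    rintro (x | x | _) (y | y | _) (z | z | _) <;>
      simp only [HAdd.hAdd]
    all_goals simp only [ChainErr.top.injEq, ChainErr.mid.injEq]
    all_goals first | exact add_assoc _ _ _ | skip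
    all_goals
      first
        | exact (congrArg (· + _) (map_add f _ _)).trans (add_assoc _ _ _)
        | exact (add_assoc _ _ _).trans (congrArg (_ + ·) (map_add f _ _).symm)
  add_comm' := by
    rintro (x | x | _) (y | y | _) <;>
      first | rfl | exact congrArg _ (add_comm _ _)
  add_zero' := by
    rintro (x | x | _)
    · exact congrArg ChainErr.top (add_zero x)
    · exact congrArg ChainErr.mid (show x + f 0 = x by simp)
    · rfl
  add_neg' := by
    rintro (x | x | _)
    · exact congrArg ChainErr.top (show x + -x = 0 * x by ring)
    · exact congrArg ChainErr.mid (show x + -x = f 0 * x by simp)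
    · rfl
  mul_assoc' := by
    rintro (x | x | _) (y | y | _) (z | z | _) <;>
      simp only [HMul.hMul]
    all_goals simp only [ChainErr.top.injEq, ChainErr.mid.injEq]
    all_goals first | exact mul_assoc _ _ _ | skip
    all_goals
      first
        | exact (congrArg (· * _) (map_mul f _ _)).trans (mul_assoc _ _ _)
        | exact (mul_assoc _ _ _).trans (congrArg (_ * ·) (map_mul f _ _).symm)
  mul_comm' := by
    rintro (x | x | _) (y | y | _) <;>
      first | rfl | exact congrArg _ (mul_comm _ _)
  one_mul' := by
    rintro (x | x | _)
    · exact congrArg ChainErr.top (one_mul x)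
    · exact congrArg ChainErr.mid (show f 1 * x = x by simp)
    · rfl
  mul_add' := by
    rintro (x | x | _) (y | y | _) (z | z | _) <;> try rfl
    · exact congrArg ChainErr.top (mul_add x y z)
    · exact congrArg ChainErr.mid (show f x * (f y + z) = f (x * y) + f x * z by
        rw [map_mul]; ring)
    · exact congrArg ChainErr.mid (show f x * (y + f z) = f x * y + f (x * z) by
        rw [map_mul]; ring)
    · exact congrArg ChainErr.mid (mul_add (f x) y z)
    · exact congrArg ChainErr.mid (show x * f (y + z) = x * f y + x * f z by
        rw [map_add]; ring)
    all_goals exact congrArg ChainErr.mid (mul_add _ _ _)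
  neg_neg' := by
    rintro (x | x | _) <;> first | rfl | exact congrArg _ (neg_neg x)
  zero_mul_add' := by
    rintro (x | x | _) (y | y | _) <;> try rfl
    · exact congrArg ChainErr.top (show 0 * (x + y) = 0 * x * y by ring)
    · exact congrArg ChainErr.mid (show f 0 * (f x + y) = f (0 * x) * y by simp)
    · exact congrArg ChainErr.mid (show f 0 * (x + f y) = f 0 * x * f y by simp)
    · exact congrArg ChainErr.mid (show f 0 * (x + y) = f 0 * x * y by simp)

end RingToRingToErr

section Five

/-- The ring of matrices `(x y; 0 x)` with `x, y ∈ ℤ/2`. -/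
def matrixM2 : Subring (Matrix (Fin 2) (Fin 2) (ZMod 2)) where
  carrier := {A | ∃ x y : ZMod 2, A = !![x, y; 0, x]}
  mul_mem' := by
    rintro _ _ ⟨x, y, rfl⟩ ⟨x', y', rfl⟩
    exact ⟨x * x', x * y' + y * x', by simp⟩
  one_mem' := ⟨1, 0, by rw [Matrix.one_fin_two]⟩
  add_mem' := by
    rintro _ _ ⟨x, y, rfl⟩ ⟨x', y', rfl⟩
    exact ⟨x + x', y + y', by simp⟩
  zero_mem' := ⟨0, 0, by ext i j; fin_cases i <;> fin_cases j <;> rfl⟩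
  neg_mem' := by
    rintro _ ⟨x, y, rfl⟩
    exact ⟨-x, -y, by simp⟩

instance matrixM2.instCommRing : CommRing matrixM2 :=
  { (inferInstance : Ring matrixM2) with
    mul_comm := by
      rintro ⟨_, x, y, rfl⟩ ⟨_, x', y', rfl⟩
      apply Subtype.ext
      change !![x, y; 0, x] * !![x', y'; 0, x'] = !![x', y'; 0, x'] * !![x, y; 0, x]
      simp only [Matrix.mul_fin_two]
      ring_nf }

/-- The carriers of the five pre-meadows: `ℤ/4`, `ℤ/2 × ℤ/2`, `𝔽₄` and `M₂`, each with `a`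
adjoined, and the chain `ℤ/2 → ℤ/2 → {a}` with the identity as first arrow. -/
def FiveMeadows : Fin 5 → Type
  | 0 => AdjoinErr (ZMod 4)
  | 1 => AdjoinErr (ZMod 2 × ZMod 2)
  | 2 => AdjoinErr (GaloisField 2 2)
  | 3 => AdjoinErr matrixM2
  | 4 => ChainErr (RingHom.id (ZMod 2))

noncomputable instance FiveMeadows.instPreMeadow : (i : Fin 5) → PreMeadow (FiveMeadows i)
  | 0 => AdjoinErr.instPreMeadow (ZMod 4)
  | 1 => AdjoinErr.instPreMeadow (ZMod 2 × ZMod 2)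
  | 2 => AdjoinErr.instPreMeadow (GaloisField 2 2)
  | 3 => AdjoinErr.instPreMeadow matrixM2
  | 4 => ChainErr.instPreMeadow (RingHom.id (ZMod 2))

end Five

/-! Every `z` in `0 * P` is idempotent for both operations, and the fibre over it is a commutative
ring with zero `z` and unit `1 + z` (`fiberCommRing`). So `P` is a disjoint union of rings. A fibre
with `1 + z = z` is the zero ring, and by uniqueness only the fibre of `a` is of this kind
(`IsErr.one_add_ne`); every other fibre has at least two elements.

In order five, four elements remain besides `a`. If all lie over `0`, then `P` is a ring of order
four with `a` adjoined. Otherwise there is one further level `z`, both fibres have order two, and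
adding `z` maps the fibre over `0`, a copy of `ℤ/2`, onto the fibre over `z`: this is the chain.

A ring of order four has characteristic 4, hence is `ℤ/4`, or characteristic 2. In the latter case
`1, x` is a basis over `ℤ/2` for any `x ≠ 0, 1`, and the equation `x² = q + p x` determines the
ring. After possibly replacing `x` by `x + 1`, the equation is `x² = 0`, `x² = x` or `x² = 1 + x`,
giving `M₂`, `ℤ/2 × ℤ/2` and `𝔽₄`.

The inverse function is forced on each model: units are inverted within their level and all else
goes to `a`. Existence and uniqueness pass along isomorphisms, and uniqueness makes every
isomorphism of pre-meadows compatible with the inverses. Four isomorphism invariants separate the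
models. -/

namespace PreMeadow

/-! ### Arithmetic in pre-meadows -/

section Arithmetic

variable {P : Type u} [PreMeadow P]

theorem zero_add'' (x : P) : 0 + x = x := by rw [add_comm', add_zero']

theorem mul_one'' (x : P) : x * 1 = x := by rw [mul_comm', one_mul']

/-- This is the axiom for `0 * (x + y)` at `x = 0`, `y = 1`. -/
theorem zero_mul_zero : (0 * 0 : P) = 0 := by
  have h := zero_mul_add' (0 : P) 1
  rwa [zero_add'', mul_one'', mul_one'', eq_comm] at h

theorem zero_mul_zero_mul (x : P) : 0 * (0 * x) = 0 * x := by
  rw [← mul_assoc', zero_mul_zero]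

theorem add_mul'' (x y z : P) : (x + y) * z = x * z + y * z := by
  rw [mul_comm', mul_add', mul_comm' z x, mul_comm' z y]

theorem zero_mul_add_self (x : P) : 0 * x + x = x := by
  conv_lhs => rw [← one_mul' x]
  rw [← mul_assoc', mul_one'', ← add_mul'', zero_add'', one_mul']

theorem add_zero_mul_self (x : P) : x + 0 * x = x := by
  rw [add_comm', zero_mul_add_self]

/-- Both sides equal `0 * (x + x)`: one by the last axiom, the other by distributivity and `0 + 0 =
0`. -/
theorem zero_mul_mul_self (x : P) : 0 * x * x = 0 * x := by
  rw [← zero_mul_add', mul_add', ← add_mul'', add_zero']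

theorem zero_mul_mul (x y : P) : 0 * (x * y) = 0 * x * (0 * y) := by
  rw [mul_assoc', ← mul_assoc' x, mul_comm' x 0, mul_assoc', zero_mul_zero_mul]

theorem zero_mul_add_eq (x y : P) : 0 * (x + y) = 0 * x * (0 * y) := by
  rw [← zero_mul_mul, zero_mul_add', mul_assoc']

theorem zero_mul_neg (x : P) : 0 * -x = 0 * x := by
  rw [← add_neg' (-x), neg_neg', add_comm', add_neg']

/-- Negatives are unique only within a level, hence `h0`: in the chain `ℤ/2 → ℤ/2 → {a}` the top
unit also cancels the middle unit. -/
theorem eq_neg_of_add_eq {x y : P} (h : x + y = 0 * x) (h0 : 0 * y = 0 * x) : y = -x := by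
  rw [← add_zero_mul_self y, h0, ← add_neg' x, ← add_assoc', add_comm' y, h, ← zero_mul_neg,
    zero_mul_add_self]

variable {z : P} (hz : 0 * z = z)
include hz

theorem add_self_of_zero_mul : z + z = z := by
  conv_lhs => rw [← hz, hz]
  nth_rw 1 [← hz]
  exact zero_mul_add_self z

theorem mul_self_of_zero_mul : z * z = z := by
  conv_lhs => rw [← hz]
  rw [hz]
  conv_lhs => enter [1]; rw [← hz]
  rw [zero_mul_mul_self, hz]

theorem zero_mul_one_add : 0 * (1 + z) = z := by
  rw [zero_mul_add', mul_one'', hz]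

end Arithmetic

/-! ### Fibres as commutative rings -/

section FiberRing

variable {P : Type u} [PreMeadow P]

/-- The fibre over an element `z` of `0 * P` is a commutative ring with zero `z`
and unit `1 + z`. -/
abbrev fiberCommRing (z : P) (hz : 0 * z = z) : CommRing (fiber z) :=
  letI : Zero (fiber z) := ⟨⟨z, hz⟩⟩
  letI : One (fiber z) := ⟨⟨1 + z, zero_mul_one_add hz⟩⟩
  letI : Add (fiber z) := ⟨fun x y => ⟨x.1 + y.1, by
    have hx : 0 * x.1 = z := x.2
    have hy : 0 * y.1 = z := y.2
    show 0 * (x.1 + y.1) = z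
    rw [zero_mul_add_eq, hx, hy, mul_self_of_zero_mul hz]⟩⟩
  letI : Mul (fiber z) := ⟨fun x y => ⟨x.1 * y.1, by
    have hx : 0 * x.1 = z := x.2
    have hy : 0 * y.1 = z := y.2
    show 0 * (x.1 * y.1) = z
    rw [zero_mul_mul, hx, hy, mul_self_of_zero_mul hz]⟩⟩
  letI : Neg (fiber z) := ⟨fun x => ⟨-x.1, (zero_mul_neg x.1).trans x.2⟩⟩
  CommRing.ofMinimalAxioms
    (fun _ _ _ => Subtype.ext (add_assoc' _ _ _))
    (by
      rintro ⟨x, rfl⟩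
      exact Subtype.ext (zero_mul_add_self x))
    (fun x => Subtype.ext (((add_comm' _ _).trans (PreMeadow.add_neg' _)).trans x.2))
    (fun _ _ _ => Subtype.ext (mul_assoc' _ _ _))
    (fun _ _ => Subtype.ext (mul_comm' _ _))
    (by
      rintro ⟨x, rfl⟩
      refine Subtype.ext (show (1 + 0 * x) * x = x from ?_)
      rw [add_mul'', zero_mul_mul_self, one_mul', add_zero_mul_self])
    (fun _ _ _ => Subtype.ext (mul_add' _ _ _))

end FiberRing

/-! ### The absorbing element -/

section Err

variable {P : Type u} [PreMeadow P] {a : P} (ha : IsErr a)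
include ha

theorem IsErr.zero_mul : 0 * a = a := by
  obtain ⟨x, hx⟩ := ha.mem
  rw [hx, zero_mul_zero_mul]

theorem IsErr.eq_of_zero_mul {x : P} (hx : 0 * x = a) : x = a := by
  obtain ⟨y, hy⟩ := Set.ncard_eq_one.1 ha.card_fiber
  have h1 : x ∈ fiber a := hx
  have h2 : a ∈ fiber a := ha.zero_mul
  rw [hy] at h1 h2
  exact h1.trans h2.symm

theorem IsErr.mul_err (x : P) : x * a = a := by
  have h := zero_mul_add' x a
  rwa [ha.add_err, ha.zero_mul, mul_assoc', mul_comm' x a, ← mul_assoc', ha.zero_mul, mul_comm',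
    eq_comm] at h

theorem IsErr.err_add (x : P) : a + x = a := by rw [add_comm', ha.add_err]

theorem IsErr.err_mul (x : P) : a * x = a := by rw [mul_comm', ha.mul_err]

/-- If unit and zero of the fibre ring over `z` agree, the fibre is the single point `z`, and
uniqueness of `a` gives `z = a`. This is the source of all lower bounds on fibre sizes. -/
theorem IsErr.one_add_ne {z : P} (hz : 0 * z = z) (hza : z ≠ a) : 1 + z ≠ z := by
  intro h
  refine hza (ha.unique z ⟨z, hz.symm⟩ (Set.ncard_eq_one.2 ⟨z, ?_⟩))
  ext x
  refine ⟨fun hx => ?_, ?_⟩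
  · have hx : 0 * x = z := hx
    rw [Set.mem_singleton_iff, ← add_zero_mul_self x, ← zero_mul_mul_self x, hx]
    nth_rw 1 [← one_mul' x]
    rw [← add_mul'', h, ← hx, zero_mul_mul_self]
  · rintro rfl
    exact hz

end Err

end PreMeadow

/-! ### Isomorphisms and transport of structure -/

namespace PreMeadowIso

open PreMeadow

variable {P : Type u} {Q : Type v} [PreMeadow P] [PreMeadow Q]

/-- A bijection preserving addition and multiplication preserves the whole structure. -/
def ofAddMul (e : P ≃ Q) (hadd : ∀ x y, e (x + y) = e x + e y)
    (hmul : ∀ x y, e (x * y) = e x * e y) : PreMeadowIso P Q :=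
  -- The constants are preserved because a surjective homomorphism carries neutral elements to
  -- neutral elements; negation then follows from `eq_neg_of_add_eq`.
  have h0 : e 0 = 0 := by
    have h := hadd (e.symm 0) 0
    rwa [add_zero', e.apply_symm_apply, zero_add'', eq_comm] at h
  { e with
    map_zero' := h0
    map_one' := by
      have h := hmul (e.symm 1) 1
      rwa [mul_one'', e.apply_symm_apply, one_mul', eq_comm] at h
    map_add' := hadd
    map_neg' := fun x => by
      apply eq_neg_of_add_eq
      · show e x + e (-x) = 0 * e x
        rw [← hadd, PreMeadow.add_neg', hmul, h0]
      · show 0 * e (-x) = 0 * e x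
        rw [← h0, ← hmul, ← hmul, zero_mul_neg]
    map_mul' := hmul }

variable (e : PreMeadowIso P Q)

theorem map_zero : e.toEquiv 0 = 0 := e.map_zero'
theorem map_one : e.toEquiv 1 = 1 := e.map_one'
theorem map_add (x y : P) : e.toEquiv (x + y) = e.toEquiv x + e.toEquiv y := e.map_add' x y
theorem map_mul (x y : P) : e.toEquiv (x * y) = e.toEquiv x * e.toEquiv y := e.map_mul' x y

/-- The inverse isomorphism. -/
def symm : PreMeadowIso Q P :=
  ofAddMul e.toEquiv.symm
    (fun x y => by rw [Equiv.symm_apply_eq, map_add]; simp)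
    (fun x y => by rw [Equiv.symm_apply_eq, map_mul]; simp)

/-- The composition of two isomorphisms. -/
def trans {R : Type*} [PreMeadow R] (e' : PreMeadowIso Q R) : PreMeadowIso P R :=
  ofAddMul (e.toEquiv.trans e'.toEquiv)
    (fun x y => by simp [map_add]) (fun x y => by simp [map_mul])

theorem image_fiber (z : P) : e.toEquiv '' fiber z = fiber (e.toEquiv z) := by
  ext y
  rw [Equiv.image_eq_preimage_symm]
  show 0 * e.toEquiv.symm y = z ↔ 0 * y = e.toEquiv z
  rw [← e.toEquiv.injective.eq_iff, map_mul, map_zero, Equiv.apply_symm_apply]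

theorem ncard_fiber (z : P) : (fiber (e.toEquiv z)).ncard = (fiber z).ncard := by
  rw [← image_fiber, Set.ncard_image_of_injective _ e.toEquiv.injective]

theorem isErr {a : P} (ha : IsErr a) : IsErr (e.toEquiv a) where
  mem := ⟨e.toEquiv a, by rw [← e.map_zero, ← e.map_mul, ha.zero_mul]⟩
  card_fiber := by rw [ncard_fiber, ha.card_fiber]
  unique := by
    rintro z ⟨x, rfl⟩ h
    obtain ⟨x, rfl⟩ := e.toEquiv.surjective x
    rw [← e.map_zero, ← e.map_mul] at h ⊢
    rw [ncard_fiber] at h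
    rw [ha.unique _ ⟨x, rfl⟩ h]
  add_err x := by
    obtain ⟨x, rfl⟩ := e.toEquiv.surjective x
    rw [← e.map_add, ha.add_err]

/-- An inverse function is transported along an isomorphism. -/
theorem isCommonInverse {inv : P → P} (h : IsCommonInverse inv) :
    IsCommonInverse fun y => e.toEquiv (inv (e.toEquiv.symm y)) where
  withErr := h.withErr.elim fun _ ha => ⟨_, e.isErr ha⟩
  mul_inv y := by
    obtain ⟨x, rfl⟩ := e.toEquiv.surjective y
    rw [Equiv.symm_apply_apply, ← map_mul, h.mul_inv, map_add, map_mul, map_one, map_zero]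
  inv_mul x y := by
    obtain ⟨x, rfl⟩ := e.toEquiv.surjective x
    obtain ⟨y, rfl⟩ := e.toEquiv.surjective y
    simp only [← map_mul, Equiv.symm_apply_apply, h.inv_mul]
  inv_one_add x := by
    obtain ⟨x, rfl⟩ := e.toEquiv.surjective x
    simp only [← e.map_zero, ← e.map_one, ← map_mul, ← map_add, Equiv.symm_apply_apply,
      h.inv_one_add]
  inv_zero := by
    have h0 : e.toEquiv.symm 0 = 0 := e.symm.map_zero
    rw [h0]
    exact e.isErr h.inv_zero

include e in
theorem existsUnique_isCommonInverse (h : ∃! inv : P → P, IsCommonInverse inv) :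
    ∃! inv : Q → Q, IsCommonInverse inv := by
  obtain ⟨inv, hinv, huniq⟩ := h
  refine ⟨_, e.isCommonInverse hinv, fun g hg => ?_⟩
  have h := huniq _ (e.symm.isCommonInverse hg)
  funext y
  have hy : e.toEquiv.symm (g (e.toEquiv (e.toEquiv.symm y))) = inv (e.toEquiv.symm y) :=
    congrFun h _
  simp only [← hy, Equiv.apply_symm_apply]

end PreMeadowIso

/-! ### Rings of order four through a quadratic equation -/

section RingsOfOrderFour

variable {R S : Type*} [CommRing R] [CommRing S]

/-- The elements `q + p x` of a ring of characteristic two. -/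
def zmodTwoComb [CharP R 2] (x : R) (c : ZMod 2 × ZMod 2) : R :=
  ZMod.castHom (dvd_refl 2) R c.1 + ZMod.castHom (dvd_refl 2) R c.2 * x

/-- An `x` outside the prime field is linearly independent of `1` over `ℤ/2`, and the four
combinations exhaust a ring of order four. -/
theorem zmodTwoComb_bijective [CharP R 2] (hR : Nat.card R = 4) {x : R} (h0 : x ≠ 0)
    (h1 : x ≠ 1) : Function.Bijective (zmodTwoComb x) := by
  have : Finite R := Nat.finite_of_card_ne_zero (by rw [hR]; norm_num)
  have : Nontrivial R := ⟨x, 0, h0⟩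
  refine Function.Injective.bijective_of_nat_card_le ?_ (by simp [hR])
  let φ : ZMod 2 × ZMod 2 →+ R :=
    { toFun := zmodTwoComb x
      map_zero' := by simp [zmodTwoComb]
      map_add' := fun c d => by simp only [zmodTwoComb, Prod.fst_add, Prod.snd_add, map_add]; ring }
  refine (injective_iff_map_eq_zero φ).2 ?_
  rintro ⟨q, p⟩ h
  have h : ZMod.castHom (dvd_refl 2) R q + ZMod.castHom (dvd_refl 2) R p * x = 0 := h
  have hp : ∀ t : ZMod 2, t = 0 ∨ t = 1 := by decide
  rcases hp q with rfl | rfl <;> rcases hp p with rfl | rfl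
  · rfl
  · exact absurd (by simpa only [map_zero, map_one, zero_add, one_mul] using h) h0
  · exact absurd (by simpa only [map_zero, map_one, zero_mul, add_zero] using h) one_ne_zero
  · refine absurd ?_ h1
    rw [map_one, one_mul] at h
    exact (CharTwo.add_eq_zero.1 h).symm

theorem zmodTwoComb_add [CharP R 2] (x : R) (u v : ZMod 2 × ZMod 2) :
    zmodTwoComb x u + zmodTwoComb x v = zmodTwoComb x (u + v) := by
  simp only [zmodTwoComb, Prod.fst_add, Prod.snd_add, map_add]
  ring

theorem zmodTwoComb_mul [CharP R 2] {x : R} {c : ZMod 2 × ZMod 2} (hx : x * x = zmodTwoComb x c)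
    (u v : ZMod 2 × ZMod 2) : zmodTwoComb x u * zmodTwoComb x v =
      zmodTwoComb x (u.1 * v.1 + u.2 * v.2 * c.1, u.1 * v.2 + u.2 * v.1 + u.2 * v.2 * c.2) := by
  simp only [zmodTwoComb, map_add, map_mul] at hx ⊢
  linear_combination (ZMod.castHom (dvd_refl 2) R u.2 * ZMod.castHom (dvd_refl 2) R v.2) * hx

/-- Two rings of order four and characteristic two are isomorphic if each has an element
other than `0`, `1`, with the same quadratic equation. -/
theorem nonempty_ringEquiv_of_sq_eq [CharP R 2] [CharP S 2] (hR : Nat.card R = 4)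
    (hS : Nat.card S = 4) {x : R} {y : S} (hx0 : x ≠ 0) (hx1 : x ≠ 1) (hy0 : y ≠ 0) (hy1 : y ≠ 1)
    (c : ZMod 2 × ZMod 2) (hx : x * x = zmodTwoComb x c) (hy : y * y = zmodTwoComb y c) :
    Nonempty (R ≃+* S) := by
  -- Both rings are put in coordinates on `ℤ/2 × ℤ/2`, where the product depends only on `c`.
  let ex := Equiv.ofBijective _ (zmodTwoComb_bijective hR hx0 hx1)
  let ey := Equiv.ofBijective _ (zmodTwoComb_bijective hS hy0 hy1)
  refine ⟨{ ex.symm.trans ey with map_mul' := fun a b => ?_, map_add' := fun a b => ?_ }⟩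
  · obtain ⟨u, rfl⟩ := ex.surjective a
    obtain ⟨v, rfl⟩ := ex.surjective b
    have h : ex u * ex v = ex _ := zmodTwoComb_mul hx u v
    have h' : ey u * ey v = ey _ := zmodTwoComb_mul hy u v
    simp only [Equiv.toFun_as_coe, Equiv.trans_apply, h, Equiv.symm_apply_apply, h']
  · obtain ⟨u, rfl⟩ := ex.surjective a
    obtain ⟨v, rfl⟩ := ex.surjective b
    have h : ex u + ex v = ex _ := zmodTwoComb_add x u v
    have h' : ey u + ey v = ey _ := zmodTwoComb_add y u v
    simp only [Equiv.toFun_as_coe, Equiv.trans_apply, h, Equiv.symm_apply_apply, h']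

theorem exists_ne_zero_ne_one_of_card (hR : Nat.card R = 4) : ∃ x : R, x ≠ 0 ∧ x ≠ 1 := by
  have : Finite R := Nat.finite_of_card_ne_zero (by rw [hR]; norm_num)
  by_contra! h
  have hu : (Set.univ : Set R) ⊆ {0, 1} := fun x _ => by
    by_cases hx : x = 0
    · exact Or.inl hx
    · exact Or.inr (h x hx)
  have h1 := Set.ncard_le_ncard hu
  have h2 := Set.ncard_insert_le (0 : R) {1}
  rw [Set.ncard_univ, hR] at h1
  rw [Set.ncard_singleton] at h2
  omega

theorem exists_sq_eq_of_card [CharP R 2] (hR : Nat.card R = 4) :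
    ∃ x : R, x ≠ 0 ∧ x ≠ 1 ∧
      (x * x = zmodTwoComb x (0, 0) ∨ x * x = zmodTwoComb x (0, 1) ∨
        x * x = zmodTwoComb x (1, 1)) := by
  obtain ⟨x, h0, h1⟩ := exists_ne_zero_ne_one_of_card hR
  obtain ⟨⟨q, p⟩, h⟩ := (zmodTwoComb_bijective hR h0 h1).2 (x * x)
  have hp : ∀ t : ZMod 2, t = 0 ∨ t = 1 := by decide
  rcases hp q with rfl | rfl <;> rcases hp p with rfl | rfl
  · exact ⟨x, h0, h1, Or.inl h.symm⟩
  · exact ⟨x, h0, h1, Or.inr (Or.inl h.symm)⟩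
  -- Here `x² = 1`, so `(x + 1)² = 0` in characteristic two.
  · refine ⟨x + 1, fun h => h1 (CharTwo.add_eq_zero.1 h), fun h => h0 (by simpa using h),
      Or.inl ?_⟩
    simp only [zmodTwoComb, map_zero, map_one, zero_mul, add_zero] at h ⊢
    linear_combination (-1 : R) * h + (x + 1) * CharTwo.two_eq_zero (R := R)
  · exact ⟨x, h0, h1, Or.inr (Or.inr h.symm)⟩

theorem nonempty_ringEquiv_zmod_four_or_charP_two (hR : Nat.card R = 4) :
    Nonempty (R ≃+* ZMod 4) ∨ CharP R 2 := by
  have : Finite R := Nat.finite_of_card_ne_zero (by rw [hR]; norm_num)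
  have := Fintype.ofFinite R
  obtain ⟨x, h0, -⟩ := exists_ne_zero_ne_one_of_card hR
  have : Nontrivial R := ⟨x, 0, h0⟩
  obtain ⟨n, hn⟩ := CharP.exists R
  -- The order of a finite ring annihilates its unit, so the characteristic divides it.
  have hd : n ∣ 4 := by
    rw [← hR, ← CharP.cast_eq_zero_iff R n, Nat.card_eq_fintype_card, Nat.cast_card_eq_zero]
  have hle := Nat.le_of_dvd (by norm_num) hd
  have hn1 : n ≠ 1 := CharP.char_ne_one R n
  interval_cases n
  · omega
  · omega
  · exact Or.inr hn
  · omega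
  · refine Or.inl ⟨(RingEquiv.ofBijective (ZMod.castHom (dvd_refl 4) R) ?_).symm⟩
    exact ZMod.castHom_bijective R (by rw [← hR, Nat.card_eq_fintype_card])

end RingsOfOrderFour

/-! ### The four rings of order four -/

section FourRings

theorem charP_two_of_card {R : Type*} [CommRing R] (hR : Nat.card R = 4) (h : (2 : R) = 0) :
    CharP R 2 := by
  obtain ⟨x, h0, -⟩ := exists_ne_zero_ne_one_of_card hR
  have : Nontrivial R := ⟨x, 0, h0⟩
  exact CharTwo.of_one_ne_zero_of_two_eq_zero one_ne_zero h

theorem card_matrixM2 : Nat.card matrixM2 = 4 := by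
  have h : Function.Bijective fun c : ZMod 2 × ZMod 2 =>
      (⟨!![c.1, c.2; 0, c.1], c.1, c.2, rfl⟩ : matrixM2) := by
    refine ⟨fun c d h => ?_, ?_⟩
    · have h : !![c.1, c.2; 0, c.1] = !![d.1, d.2; 0, d.1] := congrArg Subtype.val h
      exact Prod.ext (congrFun (congrFun h 0) 0) (congrFun (congrFun h 0) 1)
    · rintro ⟨_, x, y, rfl⟩
      exact ⟨(x, y), rfl⟩
  rw [← Nat.card_congr (Equiv.ofBijective _ h)]
  simp

theorem matrixM2_two_eq_zero : (2 : matrixM2) = 0 := by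
  apply Subtype.ext
  change (2 : Matrix (Fin 2) (Fin 2) (ZMod 2)) = 0
  decide

instance matrixM2.instCharP : CharP matrixM2 2 :=
  charP_two_of_card card_matrixM2 matrixM2_two_eq_zero

/-- The nilpotent element of `M₂`. -/
def matrixM2.eps : matrixM2 := ⟨!![0, 1; 0, 0], 0, 1, rfl⟩

theorem matrixM2.eps_ne_zero : matrixM2.eps ≠ 0 := fun h => by
  have h : !![0, 1; 0, 0] = (0 : Matrix (Fin 2) (Fin 2) (ZMod 2)) := congrArg Subtype.val h
  exact one_ne_zero (congrFun (congrFun h 0) 1)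

theorem matrixM2.eps_mul_eps : matrixM2.eps * matrixM2.eps = 0 := by
  apply Subtype.ext
  change !![0, 1; 0, 0] * !![0, 1; 0, 0] = (0 : Matrix (Fin 2) (Fin 2) (ZMod 2))
  decide

theorem matrixM2.eps_ne_one : matrixM2.eps ≠ 1 := fun h => by
  have h' := matrixM2.eps_mul_eps
  rw [h, mul_one, ← h] at h'
  exact matrixM2.eps_ne_zero h'

theorem galoisField_card_four : Nat.card (GaloisField 2 2) = 4 :=
  GaloisField.card 2 2 two_ne_zero

/-- In a field `x² = 0` and `x² = x` force `x ∈ {0, 1}`, so only the third equation is left. -/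
theorem galoisField_exists_sq : ∃ x : GaloisField 2 2, x ≠ 0 ∧ x ≠ 1 ∧
    x * x = zmodTwoComb x (1, 1) := by
  obtain ⟨x, h0, h1, h | h | h⟩ := exists_sq_eq_of_card galoisField_card_four
  · exact absurd (mul_self_eq_zero.1 (by simpa [zmodTwoComb] using h)) h0
  · refine absurd (mul_left_cancel₀ h0 ?_) h1
    simpa only [zmodTwoComb, map_zero, map_one, zero_add, one_mul, mul_one] using h
  · exact ⟨x, h0, h1, h⟩

/-- The commutative rings of order four. -/
theorem nonempty_ringEquiv_of_card_four {R : Type*} [CommRing R] (hR : Nat.card R = 4) :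
    Nonempty (R ≃+* ZMod 4) ∨ Nonempty (R ≃+* ZMod 2 × ZMod 2) ∨
      Nonempty (R ≃+* GaloisField 2 2) ∨ Nonempty (R ≃+* matrixM2) := by
  rcases nonempty_ringEquiv_zmod_four_or_charP_two hR with h | hchar
  · exact Or.inl h
  obtain ⟨x, h0, h1, h | h | h⟩ := exists_sq_eq_of_card hR
  · refine Or.inr (Or.inr (Or.inr (nonempty_ringEquiv_of_sq_eq hR card_matrixM2 h0 h1
      matrixM2.eps_ne_zero matrixM2.eps_ne_one _ h ?_)))
    rw [matrixM2.eps_mul_eps]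
    simp [zmodTwoComb]
  · have hc : Nat.card (ZMod 2 × ZMod 2) = 4 := by simp
    have := charP_two_of_card hc (by decide)
    -- The case `x² = x`, matched with the nontrivial idempotent `(1, 0)`.
    refine Or.inr (Or.inl (nonempty_ringEquiv_of_sq_eq hR hc h0 h1
      (y := (1, 0)) (by decide) (by decide) _ h ?_))
    simp [zmodTwoComb]
  · obtain ⟨y, hy0, hy1, hy⟩ := galoisField_exists_sq
    exact Or.inr (Or.inr (Or.inl
      (nonempty_ringEquiv_of_sq_eq hR galoisField_card_four h0 h1 hy0 hy1 _ h hy)))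

theorem nonempty_matrixM2_ringEquiv : Nonempty (matrixM2 ≃+*
    (Polynomial (ZMod 2) ⧸ Ideal.span {(Polynomial.X : Polynomial (ZMod 2)) ^ 2})) := by
  have hm : (Polynomial.X ^ 2 : Polynomial (ZMod 2)).Monic := Polynomial.monic_X_pow 2
  let B := AdjoinRoot.powerBasis' hm
  have hdim : B.dim = 2 := by simp [B]
  have hc : Nat.card (AdjoinRoot (Polynomial.X ^ 2 : Polynomial (ZMod 2))) = 4 := by
    have := B.finite
    rw [Module.natCard_eq_pow_finrank (K := ZMod 2), B.finrank, hdim]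
    simp
  have hchar := charP_two_of_card hc (by
    rw [← map_ofNat (AdjoinRoot.of (Polynomial.X ^ 2 : Polynomial (ZMod 2))) 2]
    exact map_zero _)
  have hsq : AdjoinRoot.root (Polynomial.X ^ 2 : Polynomial (ZMod 2)) *
      AdjoinRoot.root (Polynomial.X ^ 2) = 0 := by
    have h := AdjoinRoot.eval₂_root (Polynomial.X ^ 2 : Polynomial (ZMod 2))
    rw [Polynomial.eval₂_X_pow] at h
    exact (pow_two _).symm.trans h
  -- By degree, `X²` does not divide `X`.
  have h0 : AdjoinRoot.root (Polynomial.X ^ 2 : Polynomial (ZMod 2)) ≠ 0 := fun h => by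
    have h := AdjoinRoot.mk_eq_zero.1 h
    exact absurd (Polynomial.degree_le_of_dvd h Polynomial.X_ne_zero) (by simp)
  have h1 : AdjoinRoot.root (Polynomial.X ^ 2 : Polynomial (ZMod 2)) ≠ 1 := fun h => by
    rw [h, mul_one] at hsq
    exact h0 (h.trans hsq)
  -- `AdjoinRoot` unfolds to the quotient in the statement; both distinguished elements satisfy `x²
  -- = 0`.
  exact nonempty_ringEquiv_of_sq_eq (S := AdjoinRoot (Polynomial.X ^ 2 : Polynomial (ZMod 2)))
    card_matrixM2 hc matrixM2.eps_ne_zero matrixM2.eps_ne_one h0 h1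
    (0, 0) (by rw [matrixM2.eps_mul_eps]; simp [zmodTwoComb]) (by rw [hsq]; simp [zmodTwoComb])

end FourRings

open PreMeadow

/-! ### A ring with `a` adjoined -/

namespace AdjoinErr

theorem card_eq {R : Type u} [Finite R] : Nat.card (AdjoinErr R) = Nat.card R + 1 := by
  let e : AdjoinErr R ≃ Option R :=
    { toFun := fun x => match x with
        | .of x => some x
        | .err => none
      invFun := fun x => match x with
        | some x => .of x
        | none => .err
      left_inv := by rintro (x | _) <;> rfl
      right_inv := by rintro (_ | x) <;> rfl }
  rw [Nat.card_congr e, Finite.card_option]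

variable {R : Type u} [CommRing R]

theorem of_mul (x y : R) : (of x * of y : AdjoinErr R) = of (x * y) := rfl
theorem add_err (x : AdjoinErr R) : x + err = err := by cases x <;> rfl
theorem err_add (x : AdjoinErr R) : err + x = err := rfl
theorem mul_err (x : AdjoinErr R) : x * err = err := by cases x <;> rfl
theorem err_mul (x : AdjoinErr R) : err * x = err := rfl
theorem zero_mul_of (x : R) : (0 * of x : AdjoinErr R) = of 0 := congrArg of (zero_mul x)

theorem isErr [Nontrivial R] : IsErr (err : AdjoinErr R) where
  mem := ⟨err, rfl⟩
  card_fiber := by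
    refine Set.ncard_eq_one.2 ⟨err, ?_⟩
    ext (x | _)
    · simp [fiber, zero_mul_of]
    · simp [fiber, mul_err]
  unique := by
    rintro _ ⟨x | _, rfl⟩ h
    · obtain ⟨y, hy⟩ := Set.ncard_eq_one.1 h
      have h0 : (of 0 : AdjoinErr R) ∈ fiber (0 * of x) :=
        (zero_mul_of 0).trans (zero_mul_of x).symm
      have h1 : (of 1 : AdjoinErr R) ∈ fiber (0 * of x) :=
        (zero_mul_of 1).trans (zero_mul_of x).symm
      rw [hy] at h0 h1
      exact absurd (of.inj (h0.trans h1.symm)) zero_ne_one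
    · exact mul_err _
  add_err := add_err

open Classical in
/-- The inverse function: units are inverted, everything else goes to `err`. -/
noncomputable def inv : AdjoinErr R → AdjoinErr R
  | of x => if IsUnit x then of (Ring.inverse x) else err
  | err => err

theorem inv_of_isUnit {x : R} (hx : IsUnit x) : inv (of x) = of (Ring.inverse x) := if_pos hx

theorem inv_of_not_isUnit {x : R} (hx : ¬ IsUnit x) : inv (of x) = err := if_neg hx

theorem isCommonInverse [Nontrivial R] : IsCommonInverse (inv : AdjoinErr R → AdjoinErr R) where
  withErr := ⟨_, isErr⟩
  mul_inv := by
    rintro (x | _)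
    · by_cases hx : IsUnit x
      · rw [inv_of_isUnit hx, of_mul, Ring.mul_inverse_cancel x hx, zero_mul_of]
        exact congrArg of (add_zero 1).symm
      · rw [inv_of_not_isUnit hx, mul_err, mul_err, add_err]
    · rfl
  inv_mul := by
    rintro (x | _) (y | _)
    · rw [of_mul]
      by_cases hx : IsUnit x
      · by_cases hy : IsUnit y
        · rw [inv_of_isUnit hx, inv_of_isUnit hy, inv_of_isUnit (hx.mul hy), of_mul,
            Ring.mul_inverse_rev, mul_comm (Ring.inverse y)]
        · rw [inv_of_not_isUnit hy, inv_of_not_isUnit fun h => hy (isUnit_of_mul_isUnit_right h),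
            mul_err]
      · rw [inv_of_not_isUnit hx, inv_of_not_isUnit fun h => hx (isUnit_of_mul_isUnit_left h),
          err_mul]
    · rw [mul_err]; exact (mul_err _).symm
    · rfl
    · rfl
  inv_one_add := by
    rintro (x | _)
    · rw [zero_mul_of]
      change inv (of (1 + 0)) = of (1 + 0)
      rw [add_zero, inv_of_isUnit isUnit_one, Ring.inverse_one]
    · rfl
  inv_zero := by
    change IsErr (inv (of 0))
    rw [inv_of_not_isUnit not_isUnit_zero]
    exact isErr

/-- A value `y` in `R` at `x` in `R` satisfies `x * y = 1`, so non-units must go to `err`. A unit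
cannot: multiplicativity would give `err` as the inverse of `1`, which is fixed to be `1`. -/
theorem existsUnique_isCommonInverse [Nontrivial R] :
    ∃! inv : AdjoinErr R → AdjoinErr R, IsCommonInverse inv := by
  refine ⟨inv, isCommonInverse, fun g hg => ?_⟩
  have hone : g (of 1) = of 1 := by
    have h := hg.inv_one_add (of 1)
    rw [zero_mul_of] at h
    change g (of (1 + 0)) = of (1 + 0) at h
    rwa [add_zero] at h
  have key (x y : R) (h : g (of x) = of y) : x * y = 1 := by
    have h' := hg.mul_inv (of x)
    rw [h, of_mul, zero_mul_of] at h'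
    have := of.inj (h'.trans (add_zero' _))
    exact this
  funext x
  rcases x with x | _
  · by_cases hx : IsUnit x
    · rw [inv_of_isUnit hx]
      cases h : g (of x) with
      | of y =>
        rw [← Ring.inverse_mul_cancel_left x y hx, key x y h, mul_one]
      | err =>
        have h' := hg.inv_mul (of x) (of (Ring.inverse x))
        rw [of_mul, Ring.mul_inverse_cancel x hx, hone, h] at h'
        exact absurd h' (by rw [err_mul]; exact nofun)
    · rw [inv_of_not_isUnit hx]
      cases h : g (of x) with
      | of y => exact absurd (IsUnit.of_mul_eq_one y (key x y h)) hx
      | err => rfl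
  · cases h : g err with
    | of y =>
      have h' := hg.mul_inv err
      rw [h, err_mul, zero_mul_of] at h'
      exact absurd h' nofun
    | err => rfl

/-- Isomorphic rings have isomorphic pre-meadows. -/
def congr {S : Type v} [CommRing S] (e : R ≃+* S) : PreMeadowIso (AdjoinErr R) (AdjoinErr S) :=
  PreMeadowIso.ofAddMul
    { toFun := fun x => match x with
        | of x => of (e x)
        | err => err
      invFun := fun x => match x with
        | of x => of (e.symm x)
        | err => err
      left_inv := by rintro (x | _) <;> simp
      right_inv := by rintro (x | _) <;> simp }
    (by
      rintro (x | _) (y | _)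
      · exact congrArg of (map_add e x y)
      all_goals rfl)
    (by
      rintro (x | _) (y | _)
      · exact congrArg of (map_mul e x y)
      all_goals rfl)

end AdjoinErr

/-! ### The chain of two rings with `a` -/

namespace ChainErr

theorem card_eq {R : Type u} {S : Type v} [CommRing R] [CommRing S] [Finite R] [Finite S]
    (f : R →+* S) : Nat.card (ChainErr f) = Nat.card R + Nat.card S + 1 := by
  let e : ChainErr f ≃ Option (R ⊕ S) :=
    { toFun := fun x => match x with
        | .top x => some (.inl x)
        | .mid x => some (.inr x)
        | .err => none
      invFun := fun x => match x with
        | some (.inl x) => .top x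
        | some (.inr x) => .mid x
        | none => .err
      left_inv := by rintro (x | x | _) <;> rfl
      right_inv := by rintro (_ | x | x) <;> rfl }
  rw [Nat.card_congr e, Finite.card_option, Nat.card_sum]

variable {R : Type u} {S : Type v} [CommRing R] [CommRing S] {f : R →+* S}

theorem zero_mul_top (x : R) : (0 * top x : ChainErr f) = top 0 := congrArg top (zero_mul x)
theorem zero_mul_mid (x : S) : (0 * mid x : ChainErr f) = mid 0 :=
  congrArg mid (by rw [map_zero, zero_mul])
theorem zero_mul_err : (0 * err : ChainErr f) = err := rfl

theorem isErr [Nontrivial R] [Nontrivial S] : IsErr (err : ChainErr f) where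
  mem := ⟨err, rfl⟩
  card_fiber := by
    refine Set.ncard_eq_one.2 ⟨err, ?_⟩
    ext (x | x | _) <;> simp [fiber, zero_mul_top, zero_mul_mid, zero_mul_err]
  unique := by
    rintro _ ⟨x | x | _, rfl⟩ h
    · obtain ⟨y, hy⟩ := Set.ncard_eq_one.1 h
      have h0 : (top 0 : ChainErr f) ∈ fiber (0 * top x) :=
        (zero_mul_top 0).trans (zero_mul_top x).symm
      have h1 : (top 1 : ChainErr f) ∈ fiber (0 * top x) :=
        (zero_mul_top 1).trans (zero_mul_top x).symm
      rw [hy] at h0 h1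
      exact absurd (top.inj (h0.trans h1.symm)) zero_ne_one
    · obtain ⟨y, hy⟩ := Set.ncard_eq_one.1 h
      have h0 : (mid 0 : ChainErr f) ∈ fiber (0 * mid x) :=
        (zero_mul_mid 0).trans (zero_mul_mid x).symm
      have h1 : (mid 1 : ChainErr f) ∈ fiber (0 * mid x) :=
        (zero_mul_mid 1).trans (zero_mul_mid x).symm
      rw [hy] at h0 h1
      exact absurd (mid.inj (h0.trans h1.symm)) zero_ne_one
    · rfl
  add_err := by rintro (x | x | _) <;> rfl

/-- The inverse function of the chain `ℤ/2 → ℤ/2 → {a}`. -/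
def invZModTwo : ChainErr (RingHom.id (ZMod 2)) → ChainErr (RingHom.id (ZMod 2))
  | top x => if x = 1 then top 1 else err
  | mid x => if x = 1 then mid 1 else err
  | err => err

theorem isCommonInverse_invZModTwo : IsCommonInverse invZModTwo where
  withErr := ⟨_, isErr⟩
  mul_inv := by
    have hp : ∀ t : ZMod 2, t = 0 ∨ t = 1 := by decide
    rintro (x | x | _)
    · rcases hp x with rfl | rfl <;> rfl
    · rcases hp x with rfl | rfl <;> rfl
    · rfl
  inv_mul := by
    have hp : ∀ t : ZMod 2, t = 0 ∨ t = 1 := by decide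
    rintro (x | x | _) (y | y | _) <;> try rcases hp x with rfl | rfl
    all_goals try rcases hp y with rfl | rfl
    all_goals rfl
  inv_one_add := by
    rintro (x | x | _)
    · rw [zero_mul_top]; rfl
    · rw [zero_mul_mid]; rfl
    · rfl
  inv_zero := isErr

/-- The axiom on `1 + 0 * x` fixes the values at both units and at `err`. At the zero of either
level, `mul_inv` rules out every value but `err`. -/
theorem existsUnique_isCommonInverse :
    ∃! inv : ChainErr (RingHom.id (ZMod 2)) → ChainErr (RingHom.id (ZMod 2)),
      IsCommonInverse inv := by
  refine ⟨invZModTwo, isCommonInverse_invZModTwo, fun g hg => ?_⟩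
  have hp : ∀ t : ZMod 2, t = 0 ∨ t = 1 := by decide
  funext x
  rcases x with x | x | _
  · rcases hp x with rfl | rfl
    · have h := hg.mul_inv (top 0)
      change g (top 0) = err
      generalize g (top 0) = w at h ⊢
      rcases w with y | y | _
      · rcases hp y with rfl | rfl <;> exact absurd (top.inj h) (by decide)
      · rcases hp y with rfl | rfl <;> exact absurd (mid.inj h) (by decide)
      · rfl
    · exact hg.inv_one_add (top 0)
  · rcases hp x with rfl | rfl
    · have h := hg.mul_inv (mid 0)
      change g (mid 0) = err
      generalize g (mid 0) = w at h ⊢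
      rcases w with y | y | _
      · change mid _ = top _ at h
        cases h
      · rcases hp y with rfl | rfl <;> exact absurd (mid.inj h) (by decide)
      · rfl
    · exact hg.inv_one_add (mid 0)
  · exact hg.inv_one_add err

end ChainErr

/-! ### Classification in order five -/

namespace PreMeadow

variable {P : Type u} [PreMeadow P] {a : P}

/-- If every element other than `a` lies over `0`, then `P` is the ring `P_0` with `a` adjoined. -/
theorem nonempty_iso_adjoinErr (ha : IsErr a) (h0a : (0 : P) ≠ a)
    (h : ∀ x : P, x ≠ a → 0 * x = 0) :
    letI := fiberCommRing (0 : P) zero_mul_zero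
    Nonempty (PreMeadowIso P (AdjoinErr (fiber (0 : P)))) := by
  let := fiberCommRing (0 : P) zero_mul_zero
  let g : AdjoinErr (fiber (0 : P)) → P := fun x => match x with
    | .of x => x.1
    | .err => a
  have hne (x : fiber (0 : P)) : x.1 ≠ a := fun hx => by
    have hx' : 0 * x.1 = 0 := x.2
    rw [hx, ha.zero_mul] at hx'
    exact h0a hx'.symm
  have hg : Function.Bijective g := by
    constructor
    · rintro (x | _) (y | _) hxy
      · exact congrArg _ (Subtype.ext hxy)
      · exact absurd hxy (hne x)
      · exact absurd hxy.symm (hne y)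
      · rfl
    · intro x
      by_cases hx : x = a
      · exact ⟨.err, hx.symm⟩
      · exact ⟨.of ⟨x, h x hx⟩, rfl⟩
  refine ⟨(PreMeadowIso.ofAddMul (Equiv.ofBijective g hg) ?_ ?_).symm⟩
  · rintro (x | _) (y | _)
    · rfl
    · exact (ha.add_err _).symm
    · exact (ha.err_add _).symm
    · exact (ha.add_err _).symm
  · rintro (x | _) (y | _)
    · rfl
    · exact (ha.mul_err _).symm
    · exact (ha.err_mul _).symm
    · exact (ha.mul_err _).symm

/-- A pre-meadow of order five with `P_0` of order two and a further level `z` besides `0`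
and `a` is the chain `ℤ/2 → ℤ/2 → {a}`. -/
theorem nonempty_iso_chainErr (hP : Nat.card P = 5) (ha : IsErr a) {z : P} (hz : 0 * z = z)
    (hza : z ≠ a) (hz0 : z ≠ 0) (h0a : (0 : P) ≠ a)
    (φ : letI := fiberCommRing (0 : P) zero_mul_zero
      ZMod 2 ≃+* fiber (0 : P)) :
    Nonempty (PreMeadowIso P (ChainErr (RingHom.id (ZMod 2)))) := by
  let := fiberCommRing (0 : P) zero_mul_zero
  have : Finite P := Nat.finite_of_card_ne_zero (by rw [hP]; norm_num)
  have hφ (x : ZMod 2) : 0 * (φ x).1 = 0 := (φ x).2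
  have hφadd (x y : ZMod 2) : (φ (x + y)).1 = (φ x).1 + (φ y).1 :=
    congrArg Subtype.val (map_add φ x y)
  have hφmul (x y : ZMod 2) : (φ (x * y)).1 = (φ x).1 * (φ y).1 :=
    congrArg Subtype.val (map_mul φ x y)
  have hφ0 : (φ 0).1 = 0 := congrArg Subtype.val (map_zero φ)
  have hφ1 : (φ 1).1 = 1 := (congrArg Subtype.val (map_one φ)).trans (add_zero' (1 : P))
  have hmid (x : ZMod 2) : 0 * ((φ x).1 + z) = z := by rw [zero_mul_add', hφ, hz]
  have hφz (x : ZMod 2) : (φ x).1 * z = z := by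
    rw [← hz, ← mul_assoc', mul_comm' _ 0, hφ]
  have h1z := ha.one_add_ne hz hza
  have hp : ∀ t : ZMod 2, t = 0 ∨ t = 1 := by decide
  -- Adding `z` is the transition map from the fibre over `0` to the fibre over `z`, so the middle
  -- level is parametrised by the same `φ`.
  let g : ChainErr (RingHom.id (ZMod 2)) → P := fun x => match x with
    | .top x => (φ x).1
    | .mid x => (φ x).1 + z
    | .err => a
  -- Multiplication by `0` separates the levels; within the middle level, `1 + z ≠ z` suffices.
  have hinj : Function.Injective g := by
    rintro (x | x | _) (y | y | _) hxy
    · exact congrArg _ (φ.injective (Subtype.ext hxy))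
    · exact absurd ((hmid y).symm.trans ((congrArg (0 * ·) hxy).symm.trans (hφ x))) hz0
    · exact absurd ((hφ x).symm.trans ((congrArg (0 * ·) hxy).trans ha.zero_mul)) h0a
    · exact absurd ((hmid x).symm.trans ((congrArg (0 * ·) hxy).trans (hφ y))) hz0
    · have hxy : (φ x).1 + z = (φ y).1 + z := hxy
      rcases hp x with rfl | rfl <;> rcases hp y with rfl | rfl
      · rfl
      · rw [hφ0, hφ1, zero_add''] at hxy
        exact absurd hxy.symm h1z
      · rw [hφ0, hφ1, zero_add''] at hxy
        exact absurd hxy h1z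
      · rfl
    · exact absurd ((hmid x).symm.trans ((congrArg (0 * ·) hxy).trans ha.zero_mul)) hza
    · exact absurd ((hφ y).symm.trans ((congrArg (0 * ·) hxy).symm.trans ha.zero_mul)) h0a
    · exact absurd ((hmid y).symm.trans ((congrArg (0 * ·) hxy).symm.trans ha.zero_mul)) hza
    · rfl
  -- Surjectivity comes from counting: `2 + 2 + 1 = 5`.
  have hg : Function.Bijective g :=
    hinj.bijective_of_nat_card_le (by rw [hP, ChainErr.card_eq]; simp)
  refine ⟨(PreMeadowIso.ofAddMul (Equiv.ofBijective g hg) ?_ ?_).symm⟩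
  · rintro (x | x | _) (y | y | _)
    · exact hφadd x y
    · show (φ (x + y)).1 + z = (φ x).1 + ((φ y).1 + z)
      rw [hφadd, add_assoc']
    · exact (ha.add_err _).symm
    · show (φ (x + y)).1 + z = (φ x).1 + z + (φ y).1
      rw [hφadd, add_assoc', add_assoc', add_comm' z]
    · show (φ (x + y)).1 + z = (φ x).1 + z + ((φ y).1 + z)
      rw [hφadd, add_assoc', add_assoc', add_comm' z, add_assoc', add_self_of_zero_mul hz]
    · exact (ha.add_err _).symm
    · exact (ha.err_add _).symm
    · exact (ha.err_add _).symm
    · exact (ha.err_add _).symm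
  · rintro (x | x | _) (y | y | _)
    · exact hφmul x y
    · show (φ (x * y)).1 + z = (φ x).1 * ((φ y).1 + z)
      rw [mul_add', hφz, hφmul]
    · exact (ha.mul_err _).symm
    · show (φ (x * y)).1 + z = ((φ x).1 + z) * (φ y).1
      rw [add_mul'', mul_comm' z, hφz, hφmul]
    · show (φ (x * y)).1 + z = ((φ x).1 + z) * ((φ y).1 + z)
      rw [mul_add', add_mul'', add_mul'', hφz, mul_comm' z, hφz, mul_self_of_zero_mul hz,
        add_self_of_zero_mul hz, hφmul, add_assoc', add_self_of_zero_mul hz]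
    · exact (ha.mul_err _).symm
    · exact (ha.err_mul _).symm
    · exact (ha.err_mul _).symm
    · exact (ha.err_mul _).symm

/-- The classification of the pre-meadows with `a` of order five. -/
theorem exists_iso_fiveMeadows (hP : Nat.card P = 5) (ha : IsErr a) :
    ∃ i : Fin 5, Nonempty (PreMeadowIso P (FiveMeadows i)) := by
  let := fiberCommRing (0 : P) zero_mul_zero
  have : Finite P := Nat.finite_of_card_ne_zero (by rw [hP]; norm_num)
  -- If `0` were absorbing, `x = x + 0 = a` for every `x`.
  have h0a : (0 : P) ≠ a := fun h => by
    have hx (x : P) : x = a := by rw [← ha.add_err x, ← h, add_zero']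
    have : Subsingleton P := ⟨fun x y => (hx x).trans (hx y).symm⟩
    have := Finite.card_le_one_iff_subsingleton.2 this
    omega
  by_cases h : ∀ x : P, x ≠ a → 0 * x = 0
  · obtain ⟨e⟩ := nonempty_iso_adjoinErr ha h0a h
    have hc : Nat.card (fiber (0 : P)) = 4 := by
      have h := Nat.card_congr e.toEquiv
      rw [AdjoinErr.card_eq, hP] at h
      omega
    rcases nonempty_ringEquiv_of_card_four hc with h | h | h | h
    · exact h.elim fun f => ⟨0, ⟨e.trans (AdjoinErr.congr f)⟩⟩
    · exact h.elim fun f => ⟨1, ⟨e.trans (AdjoinErr.congr f)⟩⟩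
    · exact h.elim fun f => ⟨2, ⟨e.trans (AdjoinErr.congr f)⟩⟩
    · exact h.elim fun f => ⟨3, ⟨e.trans (AdjoinErr.congr f)⟩⟩
  · push Not at h
    obtain ⟨b, hba, hb0⟩ := h
    obtain ⟨z, hzb⟩ : ∃ z, 0 * b = z := ⟨_, rfl⟩
    have hz : 0 * z = z := by rw [← hzb, zero_mul_zero_mul]
    have hza : z ≠ a := fun h => hba (ha.eq_of_zero_mul (hzb.trans h))
    have hz0 : z ≠ 0 := hzb ▸ hb0
    -- The three distinct elements `1 + z`, `z`, `a` lie outside the fibre over `0`.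
    have hle : (fiber (0 : P)).ncard ≤ 2 := by
      have hdisj : Disjoint (fiber (0 : P)) {1 + z, z, a} := by
        rw [Set.disjoint_right]
        rintro x (rfl | rfl | rfl) (hx : 0 * _ = 0)
        · rw [zero_mul_one_add hz] at hx
          exact hz0 hx
        · exact hz0 (hz.symm.trans hx)
        · exact h0a (hx.symm.trans ha.zero_mul)
      have h3 : ({1 + z, z, a} : Set P).ncard = 3 := by
        rw [Set.ncard_eq_three]
        refine ⟨1 + z, z, a, ha.one_add_ne hz hza, fun h => ?_, hza, rfl⟩
        have h' := zero_mul_one_add hz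
        rw [h, ha.zero_mul] at h'
        exact hza h'.symm
      have := Set.ncard_union_eq hdisj
      have := Set.ncard_le_card (fiber (0 : P) ∪ {1 + z, z, a})
      omega
    have hge : 1 < (fiber (0 : P)).ncard := by
      rw [Set.one_lt_ncard]
      refine ⟨1 + 0, zero_mul_one_add zero_mul_zero, 0, zero_mul_zero,
        ha.one_add_ne zero_mul_zero h0a⟩
    have hc : Nat.card (fiber (0 : P)) = 2 := by
      rw [Nat.card_coe_set_eq]
      omega
    have := Fintype.ofFinite (fiber (0 : P))
    obtain ⟨e⟩ := nonempty_iso_chainErr hP ha hz hza hz0 h0a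
      -- A ring of prime order is the prime field.
      (ZMod.ringEquivOfPrime _ Nat.prime_two (by rw [← hc, Nat.card_eq_fintype_card]))
    exact ⟨4, ⟨e⟩⟩

end PreMeadow

/-! ### The five models: absorbing element, order, inverse -/

theorem FiveMeadows.withErr (i : Fin 5) : WithErr (FiveMeadows i) := by
  match i with
  | 0 =>
    have : Fact (1 < 4) := ⟨by norm_num⟩
    exact ⟨_, AdjoinErr.isErr (R := ZMod 4)⟩
  | 1 => exact ⟨_, AdjoinErr.isErr (R := ZMod 2 × ZMod 2)⟩
  | 2 => exact ⟨_, AdjoinErr.isErr (R := GaloisField 2 2)⟩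
  | 3 =>
    have : Nontrivial matrixM2 := ⟨_, _, matrixM2.eps_ne_zero⟩
    exact ⟨_, AdjoinErr.isErr (R := matrixM2)⟩
  | 4 => exact ⟨_, ChainErr.isErr (f := RingHom.id (ZMod 2))⟩

theorem FiveMeadows.card_eq (i : Fin 5) : Nat.card (FiveMeadows i) = 5 := by
  match i with
  | 0 => exact AdjoinErr.card_eq.trans (by simp)
  | 1 => exact AdjoinErr.card_eq.trans (by simp)
  | 2 =>
    have : Finite (GaloisField 2 2) :=
      Nat.finite_of_card_ne_zero (by rw [galoisField_card_four]; norm_num)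
    exact AdjoinErr.card_eq.trans (by rw [galoisField_card_four])
  | 3 => exact AdjoinErr.card_eq.trans (by rw [card_matrixM2])
  | 4 => exact (ChainErr.card_eq _).trans (by simp)

theorem FiveMeadows.existsUnique_isCommonInverse (i : Fin 5) :
    ∃! inv : FiveMeadows i → FiveMeadows i, IsCommonInverse inv := by
  match i with
  | 0 =>
    have : Fact (1 < 4) := ⟨by norm_num⟩
    exact AdjoinErr.existsUnique_isCommonInverse (R := ZMod 4)
  | 1 => exact AdjoinErr.existsUnique_isCommonInverse (R := ZMod 2 × ZMod 2)
  | 2 => exact AdjoinErr.existsUnique_isCommonInverse (R := GaloisField 2 2)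
  | 3 =>
    have : Nontrivial matrixM2 := ⟨_, _, matrixM2.eps_ne_zero⟩
    exact AdjoinErr.existsUnique_isCommonInverse (R := matrixM2)
  | 4 => exact ChainErr.existsUnique_isCommonInverse

/-! ### Invariants and non-isomorphism -/

section Invariants

variable {P : Type u} {Q : Type v} [PreMeadow P] [PreMeadow Q]

/-- The unit has additive order two. -/
def PreMeadow.CharTwo (P : Type u) [PreMeadow P] : Prop := (1 + 1 : P) = 0

/-- Every element is idempotent. -/
def PreMeadow.Boolean (P : Type u) [PreMeadow P] : Prop := ∀ x : P, x * x = x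

/-- There is a nonzero element of square zero. -/
def PreMeadow.HasSqZero (P : Type u) [PreMeadow P] : Prop := ∃ x : P, x ≠ 0 ∧ x * x = 0

/-- There is a level other than `0` which is not a single point. -/
def PreMeadow.HasMiddle (P : Type u) [PreMeadow P] : Prop :=
  ∃ x : P, x ≠ 0 ∧ 0 * x = x ∧ 1 + x ≠ x

theorem PreMeadowIso.charTwo (e : PreMeadowIso P Q) (h : CharTwo P) : CharTwo Q := by
  unfold CharTwo at h ⊢
  rw [← e.map_one, ← e.map_zero, ← e.map_add, h]

theorem PreMeadowIso.boolean (e : PreMeadowIso P Q) (h : Boolean P) : Boolean Q := fun y => by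
  obtain ⟨x, rfl⟩ := e.toEquiv.surjective y
  rw [← e.map_mul, h x]

theorem PreMeadowIso.hasSqZero (e : PreMeadowIso P Q) : HasSqZero P → HasSqZero Q := by
  rintro ⟨x, h0, h⟩
  refine ⟨e.toEquiv x, ?_, ?_⟩
  · rwa [← e.map_zero, e.toEquiv.injective.ne_iff]
  · rw [← e.map_mul, h, e.map_zero]

theorem PreMeadowIso.hasMiddle (e : PreMeadowIso P Q) : HasMiddle P → HasMiddle Q := by
  rintro ⟨x, h0, h, h1⟩
  refine ⟨e.toEquiv x, ?_, ?_, ?_⟩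
  · rwa [← e.map_zero, e.toEquiv.injective.ne_iff]
  · rw [← e.map_zero, ← e.map_mul, h]
  · rwa [← e.map_one, ← e.map_add, e.toEquiv.injective.ne_iff]

variable {R : Type u} [CommRing R]

theorem AdjoinErr.charTwo_iff : CharTwo (AdjoinErr R) ↔ (1 + 1 : R) = 0 :=
  AdjoinErr.of.injEq (1 + 1 : R) 0 ▸ Iff.rfl

theorem AdjoinErr.boolean_iff : Boolean (AdjoinErr R) ↔ ∀ x : R, x * x = x := by
  refine ⟨fun h x => AdjoinErr.of.inj (h (.of x)), ?_⟩
  rintro h (x | _)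
  · exact congrArg _ (h x)
  · rfl

theorem AdjoinErr.hasSqZero_iff : HasSqZero (AdjoinErr R) ↔ ∃ x : R, x ≠ 0 ∧ x * x = 0 := by
  constructor
  · rintro ⟨x | _, h0, h⟩
    · exact ⟨x, fun hx => h0 (congrArg _ hx), AdjoinErr.of.inj h⟩
    · exact absurd (show (AdjoinErr.err : AdjoinErr R) = .of 0 from h) nofun
  · rintro ⟨x, h0, h⟩
    exact ⟨.of x, fun hx => h0 (AdjoinErr.of.inj hx), congrArg _ h⟩

theorem AdjoinErr.not_hasMiddle : ¬ HasMiddle (AdjoinErr R) := by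
  rintro ⟨x | _, h0, h, h1⟩
  · rw [zero_mul_of] at h
    exact h0 h.symm
  · exact h1 rfl

end Invariants

theorem FiveMeadows.charTwo_iff (i : Fin 5) : CharTwo (FiveMeadows i) ↔ i ≠ 0 := by
  match i with
  | 0 => exact (AdjoinErr.charTwo_iff (R := ZMod 4)).trans (by decide)
  | 1 => exact (AdjoinErr.charTwo_iff (R := ZMod 2 × ZMod 2)).trans (by decide)
  | 2 =>
    exact (AdjoinErr.charTwo_iff (R := GaloisField 2 2)).trans
      (iff_of_true (CharTwo.add_self_eq_zero 1) (by decide))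
  | 3 =>
    exact (AdjoinErr.charTwo_iff (R := matrixM2)).trans
      (iff_of_true (CharTwo.add_self_eq_zero 1) (by decide))
  | 4 => exact iff_of_true (congrArg ChainErr.top (by decide : (1 + 1 : ZMod 2) = 0)) (by decide)

theorem FiveMeadows.boolean_iff (i : Fin 5) : Boolean (FiveMeadows i) ↔ i = 1 ∨ i = 4 := by
  match i with
  | 0 => exact (AdjoinErr.boolean_iff (R := ZMod 4)).trans (by decide)
  | 1 => exact (AdjoinErr.boolean_iff (R := ZMod 2 × ZMod 2)).trans (by decide)
  | 2 =>
    obtain ⟨x, h0, h1, -⟩ := galoisField_exists_sq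
    exact (AdjoinErr.boolean_iff (R := GaloisField 2 2)).trans
      (iff_of_false (fun h => h1 (mul_left_cancel₀ h0 ((h x).trans (mul_one x).symm))) (by decide))
  | 3 =>
    exact (AdjoinErr.boolean_iff (R := matrixM2)).trans (iff_of_false
      (fun h => matrixM2.eps_ne_zero ((h _).symm.trans matrixM2.eps_mul_eps)) (by decide))
  | 4 =>
    have h : ∀ x : ZMod 2, x * x = x := by decide
    refine iff_of_true ?_ (by decide)
    rintro (x | x | _)
    · exact congrArg ChainErr.top (h x)
    · exact congrArg ChainErr.mid (h x)
    · rfl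

theorem FiveMeadows.hasSqZero_iff (i : Fin 5) : HasSqZero (FiveMeadows i) ↔ i = 0 ∨ i = 3 := by
  match i with
  | 0 => exact (AdjoinErr.hasSqZero_iff (R := ZMod 4)).trans (by decide)
  | 1 => exact (AdjoinErr.hasSqZero_iff (R := ZMod 2 × ZMod 2)).trans (by decide)
  | 2 =>
    exact (AdjoinErr.hasSqZero_iff (R := GaloisField 2 2)).trans
      (iff_of_false (fun ⟨x, h0, h⟩ => h0 (mul_self_eq_zero.1 h)) (by decide))
  | 3 =>
    exact (AdjoinErr.hasSqZero_iff (R := matrixM2)).trans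
      (iff_of_true ⟨_, matrixM2.eps_ne_zero, matrixM2.eps_mul_eps⟩ (by decide))
  | 4 =>
    refine iff_of_false (fun ⟨x, h0, h⟩ => h0 ?_) (by decide)
    exact ((FiveMeadows.boolean_iff 4).2 (by decide) x).symm.trans h

theorem FiveMeadows.hasMiddle_iff (i : Fin 5) : HasMiddle (FiveMeadows i) ↔ i = 4 := by
  match i with
  | 0 => exact iff_of_false (AdjoinErr.not_hasMiddle (R := ZMod 4)) (by decide)
  | 1 => exact iff_of_false (AdjoinErr.not_hasMiddle (R := ZMod 2 × ZMod 2)) (by decide)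
  | 2 => exact iff_of_false (AdjoinErr.not_hasMiddle (R := GaloisField 2 2)) (by decide)
  | 3 => exact iff_of_false (AdjoinErr.not_hasMiddle (R := matrixM2)) (by decide)
  | 4 =>
    refine iff_of_true ⟨ChainErr.mid 0, nofun, ChainErr.zero_mul_mid 0, fun h => ?_⟩ rfl
    exact absurd (ChainErr.mid.inj (f := RingHom.id (ZMod 2)) h)
      (by decide : ¬ (1 + 0 : ZMod 2) = 0)

/-- `CharTwo` singles out `ℤ/4` and `HasMiddle` the chain; among the other three, `Boolean` holds
only for `ℤ/2 × ℤ/2` and `HasSqZero` only for `M₂`, which leaves `𝔽₄`. -/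
theorem FiveMeadows.eq_of_iso {i j : Fin 5} (e : PreMeadowIso (FiveMeadows i) (FiveMeadows j)) :
    i = j := by
  have h1 : i ≠ 0 ↔ j ≠ 0 := by
    rw [← charTwo_iff, ← charTwo_iff]
    exact ⟨e.charTwo, e.symm.charTwo⟩
  have h2 : (i = 1 ∨ i = 4) ↔ (j = 1 ∨ j = 4) := by
    rw [← boolean_iff, ← boolean_iff]
    exact ⟨e.boolean, e.symm.boolean⟩
  have h3 : (i = 0 ∨ i = 3) ↔ (j = 0 ∨ j = 3) := by
    rw [← hasSqZero_iff, ← hasSqZero_iff]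
    exact ⟨e.hasSqZero, e.symm.hasSqZero⟩
  have h4 : i = 4 ↔ j = 4 := by
    rw [← hasMiddle_iff, ← hasMiddle_iff]
    exact ⟨e.hasMiddle, e.symm.hasMiddle⟩
  omega

/-! ### The main theorem -/

theorem mainTheorem7 :
    -- the five structures are pre-meadows with `a` of order 5, pairwise non-isomorphic
    (∀ i : Fin 5, PreMeadow.WithErr (FiveMeadows i) ∧ Nat.card (FiveMeadows i) = 5) ∧
    (∀ i j : Fin 5, Nonempty (PreMeadowIso (FiveMeadows i) (FiveMeadows j)) → i = j) ∧
    -- every pre-meadow with `a` of order 5 is isomorphic to one of them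
    (∀ (P : Type u) [PreMeadow P], PreMeadow.WithErr P → Nat.card P = 5 →
      ∃ i : Fin 5, Nonempty (PreMeadowIso P (FiveMeadows i))) ∧
    -- every pre-meadow with `a` of order 5 is a common meadow, in exactly one way
    (∀ (P : Type u) [PreMeadow P], PreMeadow.WithErr P → Nat.card P = 5 →
      ∃! inv : P → P, PreMeadow.IsCommonInverse inv) ∧
    -- the five structures are common meadows, and every common meadow of order 5 is isomorphic,
    -- as a common meadow, to one of them
    (∃ inv : (i : Fin 5) → FiveMeadows i → FiveMeadows i,
      (∀ i : Fin 5, PreMeadow.IsCommonInverse (inv i)) ∧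
      ∀ (P : Type u) [PreMeadow P] (invP : P → P), PreMeadow.IsCommonInverse invP →
        Nat.card P = 5 →
        ∃ (i : Fin 5) (e : PreMeadowIso P (FiveMeadows i)),
          ∀ x : P, e.toEquiv (invP x) = inv i (e.toEquiv x)) ∧
    -- the matrix ring `M₂` is isomorphic to `ℤ/2[x]/(x²)`
    Nonempty (matrixM2 ≃+*
      (Polynomial (ZMod 2) ⧸ Ideal.span {(Polynomial.X : Polynomial (ZMod 2)) ^ 2})) := by
  refine ⟨fun i => ⟨FiveMeadows.withErr i, FiveMeadows.card_eq i⟩,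
    fun i j ⟨e⟩ => FiveMeadows.eq_of_iso e,
    fun P _ ⟨a, ha⟩ hP => exists_iso_fiveMeadows hP ha, fun P _ ⟨a, ha⟩ hP => ?_, ?_,
    nonempty_matrixM2_ringEquiv⟩
  · obtain ⟨i, ⟨e⟩⟩ := exists_iso_fiveMeadows hP ha
    exact e.symm.existsUnique_isCommonInverse (FiveMeadows.existsUnique_isCommonInverse i)
  · choose inv hinv huniq using FiveMeadows.existsUnique_isCommonInverse
    refine ⟨inv, hinv, fun P _ invP h hP => ?_⟩
    obtain ⟨a, ha⟩ := h.withErr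
    obtain ⟨i, ⟨e⟩⟩ := exists_iso_fiveMeadows hP ha
    refine ⟨i, e, fun x => ?_⟩
    -- `invP` transported along `e` is an inverse function on the model, hence equals `inv i`; so
    -- `e` respects inverses.
    have h' := congrFun (huniq i _ (e.isCommonInverse h)) (e.toEquiv x)
    simpa only [Equiv.symm_apply_apply] using h'
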